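/- Let $(M,\omega)$ be a symplectic manifold of dimension $2N$ (smooth, Hausdorff, second countable), let $A_0=C^\infty(M,\mathbb{R})$ and let $E_0=\Gamma TM$ be the $A_0$-module of smooth vector fields on $M$. Let $\lambda$ be a formal variable, and let $(A,E)$ be either $(A_0[\lambda],E_0[\lambda])$, where $E_0[\lambda]=A_0[\lambda]\otimes_{A_0}E_0$, or $(A_0[[\lambda]],E_0[[\lambda]])$, where $E_0[[\lambda]]$ is the module of formal power series in $\lambda$ with coefficients in $E_0$; extend $\omega$ to an $A$-bilinear form $\omega:E\times E\to A$. Let $T(E)$ and $S(E)$ be the tensor algebra and the symmetric algebra of the $A$-module $E$, and let $W(E)=T(E)/\mathcal{I}_W$ be the Weyl algebra of $(E,\omega)$, where $\mathcal{I}_W$ is the two-sided ideal of $T(E)$ generated by the elements $x\otimes y-y\otimes x-\lambda\,\omega(x,y)$, $x,y\in E$. Then, in both cases, there exists an isomorphism of $A$-modules $\pi: S(E)\xrightarrow{\ \cong\ }W(E)$. -/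

import Mathlib

open scoped Manifold ContDiff TensorProduct PowerSeries Polynomial

noncomputable section

/-! ### Formal power series with coefficients in a module -/

/-- `FormalSeries E` is `E[[λ]]`: formal power series `∑ xₙ λⁿ` with coefficients `xₙ` in `E`,
stored as the sequence of coefficients. -/
def FormalSeries (E : Type*) : Type _ := ℕ → E

namespace FormalSeries

/-- The coefficient of `λⁿ`. -/
def coeff {E : Type*} (n : ℕ) (x : FormalSeries E) : E := x n

@[ext]
theorem ext {E : Type*} {x y : FormalSeries E} (h : ∀ n, x.coeff n = y.coeff n) : x = y :=
  funext h

instance {E : Type*} [AddCommGroup E] : AddCommGroup (FormalSeries E) :=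
  inferInstanceAs (AddCommGroup (ℕ → E))

@[simp]
theorem coeff_add {E : Type*} [AddCommGroup E] (n : ℕ) (x y : FormalSeries E) :
    (x + y).coeff n = x.coeff n + y.coeff n := rfl

@[simp]
theorem coeff_zero {E : Type*} [AddCommGroup E] (n : ℕ) :
    (0 : FormalSeries E).coeff n = 0 := rfl

/-- Cauchy product of a scalar power series and a power series of vectors. -/
instance {A E : Type*} [CommRing A] [AddCommGroup E] [Module A E] :
    SMul A⟦X⟧ (FormalSeries E) where
  smul f x := fun n =>
    ∑ p ∈ Finset.HasAntidiagonal.antidiagonal n, PowerSeries.coeff p.1 f • x.coeff p.2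

theorem coeff_smul {A E : Type*} [CommRing A] [AddCommGroup E] [Module A E]
    (n : ℕ) (f : A⟦X⟧) (x : FormalSeries E) :
    (f • x).coeff n =
      ∑ p ∈ Finset.HasAntidiagonal.antidiagonal n, PowerSeries.coeff p.1 f • x.coeff p.2 := rfl

theorem sum_antidiagonal_assoc {V : Type*} [AddCommMonoid V] (n : ℕ) (F : ℕ → ℕ → ℕ → V) :
    ∑ p ∈ Finset.HasAntidiagonal.antidiagonal n,
        ∑ q ∈ Finset.HasAntidiagonal.antidiagonal p.1, F q.1 q.2 p.2 =
      ∑ p ∈ Finset.HasAntidiagonal.antidiagonal n,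
        ∑ q ∈ Finset.HasAntidiagonal.antidiagonal p.2, F p.1 q.1 q.2 := by
  simp only [Finset.sum_sigma']
  apply Finset.sum_nbij' (fun ⟨⟨_i, j⟩, ⟨k, l⟩⟩ ↦ ⟨(k, l + j), (l, j)⟩)
    (fun ⟨⟨i, _j⟩, ⟨k, l⟩⟩ ↦ ⟨(i + k, l), (i, k)⟩) <;> simp <;> grind

instance {A E : Type*} [CommRing A] [AddCommGroup E] [Module A E] :
    Module A⟦X⟧ (FormalSeries E) where
  one_smul x := by
    ext n
    rw [coeff_smul, Finset.sum_eq_single (0, n)]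
    · simp
    · rintro ⟨i, j⟩ h hne
      have hi : i ≠ 0 := by
        rintro rfl
        simp_all
      simp [PowerSeries.coeff_one, hi]
    · simp
  mul_smul f g x := by
    ext n
    simp only [coeff_smul, PowerSeries.coeff_mul, Finset.sum_smul, Finset.smul_sum, mul_smul]
    exact sum_antidiagonal_assoc n
      fun i j k => PowerSeries.coeff i f • PowerSeries.coeff j g • x.coeff k
  smul_zero f := by
    ext n
    simp [coeff_smul]
  smul_add f x y := by
    ext n
    simp [coeff_smul, Finset.sum_add_distrib]
  add_smul f g x := by
    ext n
    simp [coeff_smul, add_smul, Finset.sum_add_distrib]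
  zero_smul x := by
    ext n
    simp [coeff_smul]

/-- The `A[[λ]]`-bilinear extension of a bilinear form to `E[[λ]]`:
`B(∑ xᵢ λⁱ, ∑ yⱼ λʲ) = ∑ₙ (∑_{i+j=n} B(xᵢ, yⱼ)) λⁿ`. -/
def extendForm {A E : Type*} [CommRing A] [AddCommGroup E] [Module A E]
    (B : LinearMap.BilinForm A E) : LinearMap.BilinForm A⟦X⟧ (FormalSeries E) :=
  LinearMap.mk₂ A⟦X⟧
    (fun x y => PowerSeries.mk fun n =>
      ∑ p ∈ Finset.HasAntidiagonal.antidiagonal n, B (x.coeff p.1) (y.coeff p.2))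
    (fun x x' y => by
      ext n
      simp [Finset.sum_add_distrib])
    (fun f x y => by
      ext n
      simp only [PowerSeries.coeff_mk, coeff_smul, map_sum, map_smul, LinearMap.sum_apply,
        LinearMap.smul_apply, smul_eq_mul, PowerSeries.coeff_mul, Finset.mul_sum]
      exact sum_antidiagonal_assoc n
        fun i j k => PowerSeries.coeff i f * B (x.coeff j) (y.coeff k))
    (fun x y y' => by
      ext n
      simp [Finset.sum_add_distrib])
    (fun f x y => by
      ext n
      simp only [PowerSeries.coeff_mk, coeff_smul, map_sum, map_smul,
        smul_eq_mul, PowerSeries.coeff_mul, Finset.mul_sum]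
      rw [← sum_antidiagonal_assoc n
          fun i j k => PowerSeries.coeff j f * B (x.coeff i) (y.coeff k),
        ← sum_antidiagonal_assoc n
          fun i j k => PowerSeries.coeff i f * B (x.coeff j) (y.coeff k)]
      refine Finset.sum_congr rfl fun p _ => ?_
      exact (Finset.Nat.sum_antidiagonal_swap (n := p.1)
        (f := fun q => PowerSeries.coeff q.1 f * B (x.coeff q.2) (y.coeff p.2))))

end FormalSeries

/-! ### Polynomials with coefficients in a module -/

/-- `E[λ] = A[λ] ⊗ E`: polynomials in `λ` with coefficients in the `A`-module `E`. -/
abbrev FormalPolynomials (A E : Type*) [CommRing A] [AddCommGroup E] [Module A E] : Type _ :=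
  A[X] ⊗[A] E

/-- The `A[λ]`-bilinear extension of a bilinear form to `E[λ]`. -/
def FormalPolynomials.extendForm {A E : Type*} [CommRing A] [AddCommGroup E] [Module A E]
    (B : LinearMap.BilinForm A E) : LinearMap.BilinForm A[X] (FormalPolynomials A E) :=
  LinearMap.BilinForm.baseChange A[X] B

/-! ### The Weyl algebra of a module with a bilinear form -/

/-- The two-sided ideal of the tensor algebra `T(E)` generated by the elements
`x ⊗ y - y ⊗ x - l Ω(x, y)`, for `x y : E`. -/
def weylIdeal {R E : Type*} [CommRing R] [AddCommGroup E] [Module R E]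
    (Ω : LinearMap.BilinForm R E) (l : R) : TwoSidedIdeal (TensorAlgebra R E) :=
  TwoSidedIdeal.span {t | ∃ x y : E,
    t = TensorAlgebra.ι R x * TensorAlgebra.ι R y - TensorAlgebra.ι R y * TensorAlgebra.ι R x -
      algebraMap R (TensorAlgebra R E) (l * Ω x y)}

/-- The Weyl algebra `W(E)`: the quotient of `T(E)` by the two-sided ideal `weylIdeal Ω l`. -/
abbrev WeylAlgebra {R E : Type*} [CommRing R] [AddCommGroup E] [Module R E]
    (Ω : LinearMap.BilinForm R E) (l : R) : Type _ :=
  (weylIdeal Ω l).ringCon.Quotient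

/-! ### Smooth functions, vector fields and symplectic forms on a manifold -/

/-- The algebra `C^∞(M, ℝ)` of smooth real functions on an `n`-manifold. -/
abbrev SmoothFunctions (n : ℕ) (M : Type*) [TopologicalSpace M]
    [ChartedSpace (EuclideanSpace ℝ (Fin n)) M] : Type _ :=
  C^∞⟮𝓡 n, M; ℝ⟯

/-- The smooth vector fields `Γ TM` on an `n`-manifold: the smooth sections of the
tangent bundle. -/
abbrev SmoothVectorFields (n : ℕ) (M : Type*) [TopologicalSpace M]
    [ChartedSpace (EuclideanSpace ℝ (Fin n)) M] [IsManifold (𝓡 n) ∞ M] : Type _ :=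
  Cₛ^∞⟮𝓡 n; EuclideanSpace ℝ (Fin n), (TangentSpace (𝓡 n) : M → Type _)⟯

namespace SmoothVectorFields

variable {n : ℕ} {M : Type*} [TopologicalSpace M]
  [ChartedSpace (EuclideanSpace ℝ (Fin n)) M] [IsManifold (𝓡 n) ∞ M]

/-- Pointwise multiplication of a vector field by a function. -/
instance : SMul (SmoothFunctions n M) (SmoothVectorFields n M) where
  smul f X := ⟨fun p => f p • X p, f.contMDiff.smul_section X.contMDiff⟩

theorem smul_apply (f : SmoothFunctions n M) (X : SmoothVectorFields n M) (p : M) :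
    (f • X) p = f p • X p := rfl

instance : Module (SmoothFunctions n M) (SmoothVectorFields n M) where
  one_smul X := by
    ext p : 1
    exact one_smul ℝ (X p)
  mul_smul f g X := by
    ext p : 1
    exact mul_smul (f p) (g p) (X p)
  smul_zero f := by
    ext p : 1
    exact smul_zero (f p)
  smul_add f X Y := by
    ext p : 1
    exact smul_add (f p) (X p) (Y p)
  add_smul f g X := by
    ext p : 1
    exact add_smul (f p) (g p) (X p)
  zero_smul X := by
    ext p : 1
    exact zero_smul ℝ (X p)

/-- The derivative at `p` of the function `f` in the direction `v`. -/
def dirDeriv (f : M → ℝ) (p : M) (v : TangentSpace (𝓡 n) p) : ℝ :=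
  mfderiv (𝓡 n) 𝓘(ℝ, ℝ) f p v

end SmoothVectorFields

/-- A symplectic form on an `n`-manifold `M`: a smooth section of the bundle of bilinear forms
on the tangent spaces which is alternating, nondegenerate at every point and closed. -/
structure SymplecticForm (n : ℕ) (M : Type*) [TopologicalSpace M]
    [ChartedSpace (EuclideanSpace ℝ (Fin n)) M] [IsManifold (𝓡 n) ∞ M] where
  /-- The bilinear form on the tangent space at `p`. -/
  toFun : ∀ p : M, TangentSpace (𝓡 n) p →L[ℝ] TangentSpace (𝓡 n) p →L[ℝ] ℝ
  contMDiff' : ContMDiff (𝓡 n)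
    ((𝓡 n).prod 𝓘(ℝ, EuclideanSpace ℝ (Fin n) →L[ℝ] EuclideanSpace ℝ (Fin n) →L[ℝ] ℝ)) ∞
    (fun p => Bundle.TotalSpace.mk'
      (EuclideanSpace ℝ (Fin n) →L[ℝ] EuclideanSpace ℝ (Fin n) →L[ℝ] ℝ)
      (E := fun p : M => TangentSpace (𝓡 n) p →L[ℝ] TangentSpace (𝓡 n) p →L[ℝ] ℝ) p (toFun p))
  alternating' : ∀ (p : M) (v : TangentSpace (𝓡 n) p), toFun p v v = 0
  nondegenerate' : ∀ (p : M) (v : TangentSpace (𝓡 n) p), (∀ w, toFun p v w = 0) → v = 0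
  /-- `dω = 0`: the invariant formula for the exterior derivative of a 2-form,
  `dω(X, Y, Z) = X ω(Y, Z) - Y ω(X, Z) + Z ω(X, Y) - ω([X, Y], Z) + ω([X, Z], Y) - ω([Y, Z], X)`,
  vanishes on all smooth vector fields. -/
  closed' : ∀ (X Y Z : SmoothVectorFields n M) (p : M),
    SmoothVectorFields.dirDeriv (fun q => toFun q (Y q) (Z q)) p (X p)
      - SmoothVectorFields.dirDeriv (fun q => toFun q (X q) (Z q)) p (Y p)
      + SmoothVectorFields.dirDeriv (fun q => toFun q (X q) (Y q)) p (Z p)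
      - toFun p (VectorField.mlieBracket (𝓡 n) X Y p) (Z p)
      + toFun p (VectorField.mlieBracket (𝓡 n) X Z p) (Y p)
      - toFun p (VectorField.mlieBracket (𝓡 n) Y Z p) (X p) = 0

namespace SymplecticForm

variable {n : ℕ} {M : Type*} [TopologicalSpace M]
  [ChartedSpace (EuclideanSpace ℝ (Fin n)) M] [IsManifold (𝓡 n) ∞ M]

/-- The smooth function `ω(X, Y)`. -/
def eval (Ω : SymplecticForm n M) (X Y : SmoothVectorFields n M) : SmoothFunctions n M :=
  ⟨fun p => Ω.toFun p (X p) (Y p), fun p => by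
    have h := ContMDiffAt.clm_bundle_apply₂
      (E₃ := Bundle.Trivial M ℝ) (F₃ := ℝ) (Ω.contMDiff' p) (X.contMDiff p) (Y.contMDiff p)
    exact (Bundle.contMDiffAt_section p).1 h⟩

/-- A symplectic form as a `C^∞(M)`-bilinear form on the module of smooth vector fields. -/
def form (Ω : SymplecticForm n M) :
    LinearMap.BilinForm (SmoothFunctions n M) (SmoothVectorFields n M) :=
  LinearMap.mk₂ (SmoothFunctions n M) Ω.eval
    (fun X X' Y => by
      ext p
      exact (Ω.toFun p).map_add₂ (X p) (X' p) (Y p))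
    (fun f X Y => by
      ext p
      exact (Ω.toFun p).map_smul₂ (f p) (X p) (Y p))
    (fun X Y Y' => by
      ext p
      exact (Ω.toFun p (X p)).map_add (Y p) (Y' p))
    (fun f X Y => by
      ext p
      exact (Ω.toFun p (X p)).map_smul (f p) (Y p))

end SymplecticForm

end

/-!
Write `W(Ω, l)` for the Weyl algebra of a module `E` over a commutative ring `R`. If `B` is a
bilinear form on `E` with `B(x, y) - B(y, x) = l (Ω(x, y) - Ω'(x, y))`, then `W(Ω, l)` and
`W(Ω', l)` are isomorphic as `R`-modules: this is the Weyl analogue of the way a change of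
quadratic form acts on Clifford algebras (`CliffordAlgebra.changeForm`), and no basis,
flatness or projectivity of `E` is involved.

A linear functional `d` on `E` extends to a derivation `∂_d` of `W(Ω', l)`
(`WeylAlgebra.contract`), because the commutator relations are sent to zero. Since
`[∂_d, x] = d(x)` as operators and the derivations `∂_d` commute with each other, the operators
`x + ∂_{B(x, ·)}` on `W(Ω', l)` satisfy the relations of `W(Ω, l)`. Letting the resulting action
of `W(Ω, l)` on `W(Ω', l)` act on `1` gives a linear map `W(Ω, l) → W(Ω', l)`
(`WeylAlgebra.changeForm`). It commutes with the derivations `∂_d`, whence the map built from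
`-B` is its inverse.

For `Ω' = 0` the target is the symmetric algebra. When `2` is invertible and `Ω` is
skew-symmetric, `B = (l / 2) Ω` is admissible, and the inverse of `changeForm` is the
symmetrization map (Weyl ordering): it sends `x ^ n` to `x ^ n` for `x ∈ E`. Both extensions of a
symplectic form, to `E[λ]` and to `E[[λ]]`, are skew-symmetric, and `2` is invertible because
`C^∞(M)` is a real algebra.
-/

noncomputable section

namespace WeylAlgebra

variable {R E : Type*} [CommRing R] [AddCommGroup E] [Module R E]

/-! ### Universal property -/

section Basic

variable (Ω : LinearMap.BilinForm R E) (l : R)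

/-- The canonical linear map `E → W(E)`. -/
def ι : E →ₗ[R] WeylAlgebra Ω l :=
  (RingCon.mkₐ R (weylIdeal Ω l).ringCon).toLinearMap ∘ₗ TensorAlgebra.ι R

theorem mk_ι (x : E) :
    RingCon.mkₐ R (weylIdeal Ω l).ringCon (TensorAlgebra.ι R x) = ι Ω l x := rfl

/-- The defining relation of the Weyl algebra. -/
theorem ι_mul_ι_sub (x y : E) :
    ι Ω l x * ι Ω l y - ι Ω l y * ι Ω l x = algebraMap R (WeylAlgebra Ω l) (l * Ω x y) := by
  have h : TensorAlgebra.ι R x * TensorAlgebra.ι R y - TensorAlgebra.ι R y * TensorAlgebra.ι R x -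
      algebraMap R (TensorAlgebra R E) (l * Ω x y) ∈ weylIdeal Ω l :=
    TwoSidedIdeal.subset_span ⟨x, y, rfl⟩
  rw [← TwoSidedIdeal.rel_iff] at h
  have h' : RingCon.mkₐ R (weylIdeal Ω l).ringCon
      (TensorAlgebra.ι R x * TensorAlgebra.ι R y - TensorAlgebra.ι R y * TensorAlgebra.ι R x) =
      RingCon.mkₐ R (weylIdeal Ω l).ringCon (algebraMap R (TensorAlgebra R E) (l * Ω x y)) :=
    (RingCon.eq _).2 h
  rwa [map_sub, map_mul, map_mul, AlgHom.commutes, mk_ι, mk_ι] at h'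

variable {Ω l}

/-- A linear map into an associative algebra that satisfies the Weyl relations extends to an
algebra homomorphism on the Weyl algebra. -/
def lift {B : Type*} [Ring B] [Algebra R B] (f : E →ₗ[R] B)
    (hf : ∀ x y, f x * f y - f y * f x = algebraMap R B (l * Ω x y)) :
    WeylAlgebra Ω l →ₐ[R] B :=
  RingCon.liftₐ (weylIdeal Ω l).ringCon (TensorAlgebra.lift R f) (by
    have hle : weylIdeal Ω l ≤ TwoSidedIdeal.ker (TensorAlgebra.lift R f) := by
      refine TwoSidedIdeal.span_le.2 ?_
      rintro _ ⟨x, y, rfl⟩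
      simp [TwoSidedIdeal.mem_ker, hf]
    exact TwoSidedIdeal.ringCon_le_iff.1 hle)

@[simp]
theorem lift_ι {B : Type*} [Ring B] [Algebra R B] (f : E →ₗ[R] B)
    (hf : ∀ x y, f x * f y - f y * f x = algebraMap R B (l * Ω x y)) (x : E) :
    lift f hf (ι Ω l x) = f x :=
  TensorAlgebra.lift_ι_apply f x

/-- The Weyl algebra is spanned by products of elements of `E`, so a property holds everywhere if
it holds for scalars and is stable under addition and left multiplication by elements of `E`. -/
theorem left_induction {P : WeylAlgebra Ω l → Prop}
    (algebraMap : ∀ r, P (algebraMap R (WeylAlgebra Ω l) r))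
    (add : ∀ a b, P a → P b → P (a + b))
    (ι_mul : ∀ x a, P a → P (ι Ω l x * a)) (a : WeylAlgebra Ω l) : P a := by
  -- `P` need not be stable under scalars, so the statement carried along the induction on `t`
  -- quantifies over all scalar multiples.
  have key : ∀ (t : TensorAlgebra R E) (b : WeylAlgebra Ω l), (∀ r : R, P (r • b)) →
      ∀ r : R, P (r • (RingCon.mkₐ R (weylIdeal Ω l).ringCon t * b)) := by
    intro t
    induction t using TensorAlgebra.induction with
    | algebraMap s =>
      intro b hb r
      rw [AlgHom.commutes, ← Algebra.smul_def, smul_smul]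
      exact hb _
    | ι x =>
      intro b hb r
      rw [mk_ι, ← mul_smul_comm]
      exact ι_mul _ _ (hb r)
    | mul s t hs ht =>
      intro b hb r
      rw [map_mul, mul_assoc]
      exact hs _ (ht b hb) r
    | add s t hs ht =>
      intro b hb r
      rw [map_add, add_mul, smul_add]
      exact add _ _ (hs b hb r) (ht b hb r)
  obtain ⟨t, rfl⟩ : ∃ t, RingCon.mkₐ R (weylIdeal Ω l).ringCon t = a := Quotient.exists_rep a
  simpa using key t 1 (fun r => by
    rw [← Algebra.algebraMap_eq_smul_one]
    exact algebraMap r) 1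

theorem algHom_ext {B : Type*} [Ring B] [Algebra R B] {f g : WeylAlgebra Ω l →ₐ[R] B}
    (h : ∀ x, f (ι Ω l x) = g (ι Ω l x)) : f = g := by
  refine AlgHom.ext fun a => ?_
  induction a using left_induction with
  | algebraMap r => rw [AlgHom.commutes, AlgHom.commutes]
  | add a b ha hb => rw [map_add, map_add, ha, hb]
  | ι_mul x a ha => rw [map_mul, map_mul, h, ha]

end Basic

/-! ### Derivations extending linear functionals -/

section Contract

variable (Ω : LinearMap.BilinForm R E) (l : R)

/-- The first-order deformation `x ↦ x + d(x) ε` of the identity, as an algebra homomorphism into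
the dual numbers over the Weyl algebra. -/
def dualNumberLift (d : Module.Dual R E) :
    WeylAlgebra Ω l →ₐ[R] TrivSqZeroExt (WeylAlgebra Ω l) (WeylAlgebra Ω l) :=
  lift ((TrivSqZeroExt.inlAlgHom R (WeylAlgebra Ω l) (WeylAlgebra Ω l)).toLinearMap ∘ₗ ι Ω l +
      (TrivSqZeroExt.inrHom (WeylAlgebra Ω l) (WeylAlgebra Ω l)).restrictScalars R ∘ₗ
        Algebra.linearMap R (WeylAlgebra Ω l) ∘ₗ d)
    (fun x y => by
      refine TrivSqZeroExt.ext ?_ ?_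
      · simpa using! ι_mul_ι_sub Ω l x y
      · have hs : (algebraMap R (TrivSqZeroExt (WeylAlgebra Ω l) (WeylAlgebra Ω l))
            (l * Ω x y)).snd = 0 := rfl
        rw [hs]
        simp [add_comm])

theorem fst_dualNumberLift (d : Module.Dual R E) (a : WeylAlgebra Ω l) :
    (dualNumberLift Ω l d a).fst = a := by
  have h : (TrivSqZeroExt.fstHom R (WeylAlgebra Ω l) (WeylAlgebra Ω l)).comp
      (dualNumberLift Ω l d) = AlgHom.id R _ := algHom_ext fun x => by simp [dualNumberLift]
  exact DFunLike.congr_fun h a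

/-- The derivation `∂_d` of the Weyl algebra that extends the linear functional `d`, i.e. the
`ε`-coefficient of `dualNumberLift`. -/
def contract (d : Module.Dual R E) : WeylAlgebra Ω l →ₗ[R] WeylAlgebra Ω l :=
  (TrivSqZeroExt.sndHom (WeylAlgebra Ω l) (WeylAlgebra Ω l)).restrictScalars R ∘ₗ
    (dualNumberLift Ω l d).toLinearMap

variable {Ω l}

@[simp]
theorem contract_algebraMap (d : Module.Dual R E) (r : R) :
    contract Ω l d (algebraMap R _ r) = 0 := by
  simp only [contract, LinearMap.comp_apply, AlgHom.toLinearMap_apply, AlgHom.commutes]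
  rfl

theorem contract_ι_mul (d : Module.Dual R E) (x : E) (a : WeylAlgebra Ω l) :
    contract Ω l d (ι Ω l x * a) = d x • a + ι Ω l x * contract Ω l d a := by
  have hx : (dualNumberLift Ω l d (ι Ω l x)).snd = algebraMap R _ (d x) := by
    simp [dualNumberLift, Algebra.algebraMap_eq_smul_one]
  simp [contract, TrivSqZeroExt.snd_mul, fst_dualNumberLift, hx, Algebra.smul_def, add_comm]

theorem contract_add (d d' : Module.Dual R E) :
    contract Ω l (d + d') = contract Ω l d + contract Ω l d' := by
  ext a
  induction a using left_induction with
  | algebraMap r => simp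
  | add a b ha hb => rw [map_add, map_add, ha, hb]
  | ι_mul x a ha =>
    simp only [LinearMap.add_apply] at ha ⊢
    simp only [contract_ι_mul, ha, LinearMap.add_apply, add_smul, mul_add]
    abel

theorem contract_smul (r : R) (d : Module.Dual R E) :
    contract Ω l (r • d) = r • contract Ω l d := by
  ext a
  induction a using left_induction with
  | algebraMap r => simp
  | add a b ha hb => rw [map_add, map_add, ha, hb]
  | ι_mul x a ha =>
    simp only [LinearMap.smul_apply] at ha ⊢
    simp only [contract_ι_mul, ha, LinearMap.smul_apply, smul_add, smul_eq_mul, mul_smul,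
      mul_smul_comm]

theorem contract_neg (d : Module.Dual R E) : contract Ω l (-d) = -contract Ω l d :=
  map_neg (AddMonoidHom.mk' (contract Ω l) contract_add) d

theorem contract_comm (d d' : Module.Dual R E) (a : WeylAlgebra Ω l) :
    contract Ω l d (contract Ω l d' a) = contract Ω l d' (contract Ω l d a) := by
  induction a using left_induction with
  | algebraMap r => simp
  | add a b ha hb => simp only [map_add, ha, hb]
  | ι_mul x a ha =>
    simp only [contract_ι_mul, map_add, map_smul, ha]
    abel

end Contract

/-! ### Changing the form -/

section ChangeForm

variable {Ω Ω' : LinearMap.BilinForm R E} {l : R}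

/-- The operator `x + ∂_{B(x, ·)}` on `W(Ω', l)`, as a linear function of `x`. -/
def twistedMul (Ω' : LinearMap.BilinForm R E) (l : R) (B : LinearMap.BilinForm R E) :
    E →ₗ[R] Module.End R (WeylAlgebra Ω' l) where
  toFun x := LinearMap.mulLeft R (ι Ω' l x) + contract Ω' l (B x)
  map_add' x y := by
    ext a
    simp only [map_add, contract_add, LinearMap.add_apply, LinearMap.mulLeft_apply, add_mul]
    abel
  map_smul' r x := by
    ext a
    simp [contract_smul]

theorem twistedMul_apply (B : LinearMap.BilinForm R E) (x : E) (a : WeylAlgebra Ω' l) :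
    twistedMul Ω' l B x a = ι Ω' l x * a + contract Ω' l (B x) a := rfl

/-- The action of `W(Ω, l)` on `W(Ω', l)` in which `x ∈ E` acts by `x + ∂_{B(x, ·)}`. -/
def twistedAction (B : LinearMap.BilinForm R E)
    (hB : ∀ x y, B x y - B y x = l * Ω x y - l * Ω' x y) :
    WeylAlgebra Ω l →ₐ[R] Module.End R (WeylAlgebra Ω' l) :=
  lift (twistedMul Ω' l B) (fun x y => by
    ext a
    have h := congrArg (· * a) (ι_mul_ι_sub Ω' l x y)
    simp only [sub_mul, mul_assoc, ← Algebra.smul_def] at h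
    have hl : l * Ω x y = l * Ω' x y + (B x y - B y x) := by rw [hB]; ring
    rw [Module.algebraMap_end_apply, hl, add_smul, ← h, sub_smul]
    simp only [LinearMap.sub_apply, Module.End.mul_apply, twistedMul_apply, map_add,
      contract_ι_mul, contract_comm (B y) (B x)]
    abel)

/-- The linear map `W(Ω, l) → W(Ω', l)` given by the value at `1` of the twisted action. -/
def changeForm (B : LinearMap.BilinForm R E)
    (hB : ∀ x y, B x y - B y x = l * Ω x y - l * Ω' x y) :
    WeylAlgebra Ω l →ₗ[R] WeylAlgebra Ω' l :=
  LinearMap.applyₗ 1 ∘ₗ (twistedAction B hB).toLinearMap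

section

variable (B : LinearMap.BilinForm R E) (hB : ∀ x y, B x y - B y x = l * Ω x y - l * Ω' x y)

@[simp]
theorem changeForm_algebraMap (r : R) :
    changeForm B hB (algebraMap R _ r) = algebraMap R _ r := by
  simp [changeForm, Algebra.algebraMap_eq_smul_one]

theorem changeForm_ι_mul (x : E) (a : WeylAlgebra Ω l) :
    changeForm B hB (ι Ω l x * a) =
      ι Ω' l x * changeForm B hB a + contract Ω' l (B x) (changeForm B hB a) := by
  simp [changeForm, twistedAction, twistedMul_apply]

theorem changeForm_contract (d : Module.Dual R E) (a : WeylAlgebra Ω l) :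
    changeForm B hB (contract Ω l d a) = contract Ω' l d (changeForm B hB a) := by
  induction a using left_induction with
  | algebraMap r => simp
  | add a b ha hb => simp only [map_add, ha, hb]
  | ι_mul x a ha =>
    simp only [contract_ι_mul, changeForm_ι_mul, map_add, map_smul, ha,
      contract_comm (B x) d]
    abel

end

theorem changeForm_changeForm {B B' : LinearMap.BilinForm R E} (h : B' = -B)
    (hB : ∀ x y, B x y - B y x = l * Ω x y - l * Ω' x y)
    (hB' : ∀ x y, B' x y - B' y x = l * Ω' x y - l * Ω x y) (a : WeylAlgebra Ω l) :
    changeForm B' hB' (changeForm B hB a) = a := by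
  induction a using left_induction with
  | algebraMap r => simp
  | add a b ha hb => simp only [map_add, ha, hb]
  | ι_mul x a ha =>
    have hneg : B' x = -B x := by rw [h, LinearMap.neg_apply]
    rw [changeForm_ι_mul, map_add, changeForm_ι_mul, changeForm_contract, ha, hneg,
      contract_neg, LinearMap.neg_apply, neg_add_cancel_right]

/-- Weyl algebras of forms whose difference is the skew part of a bilinear form are isomorphic as
modules. -/
def changeFormEquiv (B : LinearMap.BilinForm R E)
    (hB : ∀ x y, B x y - B y x = l * Ω x y - l * Ω' x y) :
    WeylAlgebra Ω l ≃ₗ[R] WeylAlgebra Ω' l :=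
  have hB' : ∀ x y, (-B) x y - (-B) y x = l * Ω' x y - l * Ω x y := fun x y => by
    simp only [LinearMap.neg_apply]
    linear_combination -hB x y
  LinearEquiv.ofLinearMap (changeForm B hB) (changeForm (-B) hB')
    (LinearMap.ext fun a => changeForm_changeForm (neg_neg B).symm hB' hB a)
    (LinearMap.ext fun a => changeForm_changeForm rfl hB hB' a)

end ChangeForm

/-! ### Comparison with the symmetric algebra -/

/-- The algebra homomorphism from the symmetric algebra to the Weyl algebra of the zero form that is
the identity on `E`. -/
def ofSymmetricAlgebra (l : R) :
    SymmetricAlgebra R E →ₐ[R] WeylAlgebra (0 : LinearMap.BilinForm R E) l :=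
  RingCon.liftₐ (TensorAlgebra.symRingCon R E) (TensorAlgebra.lift R (ι 0 l)) (by
    refine RingCon.ringConGen_le.2 fun s t h => ?_
    induction h with
    | mul_comm x y =>
      rw [RingCon.ker_apply]
      simpa [sub_eq_zero] using ι_mul_ι_sub (0 : LinearMap.BilinForm R E) l x y)

@[simp]
theorem ofSymmetricAlgebra_ι (l : R) (x : E) :
    ofSymmetricAlgebra l (SymmetricAlgebra.ι R E x) = ι 0 l x :=
  TensorAlgebra.lift_ι_apply _ x

/-- The symmetric algebra is the Weyl algebra of the zero form. -/
def symmetricAlgebraEquiv (l : R) :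
    SymmetricAlgebra R E ≃ₐ[R] WeylAlgebra (0 : LinearMap.BilinForm R E) l :=
  AlgEquiv.ofAlgHom (ofSymmetricAlgebra l)
    (lift (SymmetricAlgebra.ι R E) fun x y => by simp [mul_comm])
    (algHom_ext fun x => by simp)
    (SymmetricAlgebra.algHom_ext (LinearMap.ext fun x => by simp))

/-- Over a ring in which `2` is invertible, the Weyl algebra of a skew-symmetric form is
isomorphic, as a module, to the symmetric algebra. -/
def symmetricAlgebraLinearEquiv [Invertible (2 : R)] (Ω : LinearMap.BilinForm R E)
    (hΩ : ∀ x y, Ω x y = -Ω y x) (l : R) : SymmetricAlgebra R E ≃ₗ[R] WeylAlgebra Ω l :=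
  (symmetricAlgebraEquiv l).toLinearEquiv ≪≫ₗ
    (changeFormEquiv ((⅟2 * l) • Ω) fun x y => by
      simp only [LinearMap.smul_apply, smul_eq_mul, LinearMap.zero_apply, mul_zero, sub_zero]
      rw [hΩ y x]
      linear_combination l * Ω x y * invOf_mul_self (2 : R)).symm

end WeylAlgebra

/-! ### Skew-symmetry of the extended forms -/

section Extension

variable {A E : Type*} [CommRing A] [AddCommGroup E] [Module A E]

theorem FormalSeries.extendForm_skew {B : LinearMap.BilinForm A E}
    (hB : ∀ x y, B x y = -B y x) (x y : FormalSeries E) :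
    FormalSeries.extendForm B x y = -FormalSeries.extendForm B y x := by
  ext n
  simp only [FormalSeries.extendForm, LinearMap.mk₂_apply, PowerSeries.coeff_mk, map_neg]
  rw [← Finset.Nat.sum_antidiagonal_swap, ← Finset.sum_neg_distrib]
  exact Finset.sum_congr rfl fun p _ => hB _ _

theorem FormalPolynomials.extendForm_skew {B : LinearMap.BilinForm A E}
    (hB : ∀ x y, B x y = -B y x) (x y : FormalPolynomials A E) :
    FormalPolynomials.extendForm B x y = -FormalPolynomials.extendForm B y x := by
  -- Both sides are biadditive, so pure tensors suffice.
  induction x using TensorProduct.induction_on with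
  | zero => simp
  | add x x' hx hx' => simp only [map_add, LinearMap.add_apply, hx, hx', neg_add]
  | tmul p x =>
    induction y using TensorProduct.induction_on with
    | zero => simp
    | add y y' hy hy' => simp only [map_add, LinearMap.add_apply, hy, hy', neg_add]
    | tmul q y =>
      simp only [FormalPolynomials.extendForm, LinearMap.BilinForm.baseChange_tmul]
      rw [hB x y, neg_smul, mul_comm]

end Extension

theorem SymplecticForm.form_skew {n : ℕ} {M : Type*} [TopologicalSpace M]
    [ChartedSpace (EuclideanSpace ℝ (Fin n)) M] [IsManifold (𝓡 n) ∞ M]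
    (Ω : SymplecticForm n M) (X Y : SmoothVectorFields n M) : Ω.form X Y = -Ω.form Y X := by
  ext p
  -- Polarization of `ω(X + Y, X + Y) = 0`.
  have h := Ω.alternating' p (X p + Y p)
  simp only [map_add, _root_.add_apply, Ω.alternating', zero_add, add_zero] at h
  exact eq_neg_of_add_eq_zero_right h

end

/-- For a symplectic manifold `(M, Ω)` of dimension `2N`, with `A = C^∞(M)` and `E = Γ TM`, the
symmetric algebra and the Weyl algebra are isomorphic as modules, both over `A[λ]` (with the
module `E[λ] = A[λ] ⊗ E`) and over `A[[λ]]` (with the module `E[[λ]]`). -/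
theorem mainTheorem2 {N : ℕ} {M : Type*} [TopologicalSpace M] [T2Space M]
    [SecondCountableTopology M] [ChartedSpace (EuclideanSpace ℝ (Fin (2 * N))) M]
    [IsManifold (𝓡 (2 * N)) ∞ M] (Ω : SymplecticForm (2 * N) M) :
    Nonempty (SymmetricAlgebra (SmoothFunctions (2 * N) M)[X]
          (FormalPolynomials (SmoothFunctions (2 * N) M) (SmoothVectorFields (2 * N) M))
        ≃ₗ[(SmoothFunctions (2 * N) M)[X]]
          WeylAlgebra (FormalPolynomials.extendForm Ω.form) Polynomial.X) ∧
    Nonempty (SymmetricAlgebra (SmoothFunctions (2 * N) M)⟦X⟧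
          (FormalSeries (SmoothVectorFields (2 * N) M))
        ≃ₗ[(SmoothFunctions (2 * N) M)⟦X⟧]
          WeylAlgebra (FormalSeries.extendForm Ω.form) PowerSeries.X) := by
  let A := SmoothFunctions (2 * N) M
  -- The unit `2` of `ℝ` maps to a unit of every `C^∞(M)`-algebra.
  have h2 : ∀ (S : Type _) [CommRing S] [Algebra A S], Nonempty (Invertible (2 : S)) := by
    intro S _ _
    have h : IsUnit (algebraMap A S (algebraMap ℝ A 2)) :=
      ((isUnit_iff_ne_zero.2 two_ne_zero).map (algebraMap ℝ A)).map (algebraMap A S)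
    rw [map_ofNat, map_ofNat] at h
    exact h.nonempty_invertible
  obtain ⟨_⟩ := h2 A[X]
  obtain ⟨_⟩ := h2 A⟦X⟧
  exact ⟨⟨WeylAlgebra.symmetricAlgebraLinearEquiv _
      (FormalPolynomials.extendForm_skew Ω.form_skew) _⟩,
    ⟨WeylAlgebra.symmetricAlgebraLinearEquiv _
      (FormalSeries.extendForm_skew Ω.form_skew) _⟩⟩
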